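/- Let $n\ge 0$ and consider $n$ agents with dynamics $\dot x_i=A_ix_i+b_iu_i$, where $x_i\in\mathbb R^{m_i}$, $m_i\ge 1$, $A_i\in\mathbb R^{m_i\times m_i}$, $b_i\in\mathbb R^{m_i}$ and $u_i$ is scalar. A linear control system is called controllable if for every initial time $t_0$, every initial state and every target state, there are a finite time $T>t_0$ and an integrable input on $[t_0,T]$ that steers the initial state at time $t_0$ to the target state at time $T$; the pair $(A_i,b_i)$ is controllable if $\dot x_i=A_ix_i+b_iu_i$ is. The agents are the vertices of a weighted undirected graph $\mathbb G$ without loops, with weights $a_{ij}=a_{ji}>0$ if $i,j$ are adjacent and $a_{ij}=0$ otherwise, and some of the agents (an arbitrary subset) are leaders, the others being followers. The agents are coupled by the protocol $$u_i=-\alpha_i^TT_ix_i+\sum_{j}a_{ij}\bigl(\beta_j^TT_jx_j-\beta_i^TT_ix_i\bigr)+u_{oi},\qquad i=1,\dots,n,$$ where $u_{oi}$ is the external control on agent $i$ if $i$ is a leader and $u_{oi}=0$ if $i$ is a follower, $\beta_i\in\mathbb R^{m_i}$ are feedback gains to be chosen, and $T_i\in\mathbb R^{m_i\times m_i}$, $\alpha_i\in\mathbb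 R^{m_i}$ are given and such that, whenever $(A_i,b_i)$ is controllable, $T_i$ brings it to controllable canonical form, i.e. $T_i$ is invertible, $T_ib_i=(0,\dots,0,1)^T$, and $T_iA_iT_i^{-1}$ has ones on the superdiagonal, last row $\alpha_i^T$ and zeros elsewhere (when $(A_i,b_i)$ is not controllable, $T_i$ and $\alpha_i$ are arbitrary). The network is called controllable if for any initial time $t_0$, any initial state $x_0=(x_1(t_0),\dots,x_n(t_0))$ and any target state $x^*$ there are a finite time $T>t_0$, integrable external controls on $[t_0,T]$ and gains $\beta_1,\dots,\beta_n$ for which $x(T)=x^*$. Theorem. The network is controllable if and only if (i) every pair $(A_i,b_i)$, $i=1,\dots,n$, is controllable, and (ii) $\mathbb G$ is leader-follower connected, i.e. each connected component of $\mathbb G$ contains at least one leader. The same equivalence holds if the gains are required not to depend on the states: there are gains $\beta_1,\dots,\beta_n$ for which the resulting closed-loop linear system, with the external controls of the leaders as input, is controllable, if and only if (i) and (ii) hold. -/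

import Mathlib

open scoped Matrix
open MeasureTheory Set

/-- `x` is a trajectory on the time interval `[t₀, T]` of the control system `ẋ = F x u` driven by
the integrable input `u`, in integrated (Carathéodory) form. (For the systems below `F` is linear
in the pair `(x, u)`, so the integrand is integrable.) -/
def IsTrajectory {X U : Type*} [NormedAddCommGroup X] [NormedSpace ℝ X] [NormedAddCommGroup U]
    (F : X → U → X) (t₀ T : ℝ) (u : ℝ → U) (x : ℝ → X) : Prop :=
  IntervalIntegrable u volume t₀ T ∧ ContinuousOn x (Icc t₀ T) ∧
    ∀ t ∈ Icc t₀ T, x t = x t₀ + ∫ s in t₀..t, F (x s) (u s)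

/-- The state `x₀` at time `t₀` can be steered to the state `x₁` within a finite time. -/
def CanSteer {X U : Type*} [NormedAddCommGroup X] [NormedSpace ℝ X] [NormedAddCommGroup U]
    (F : X → U → X) (t₀ : ℝ) (x₀ x₁ : X) : Prop :=
  ∃ T : ℝ, t₀ < T ∧ ∃ (u : ℝ → U) (x : ℝ → X),
    IsTrajectory F t₀ T u x ∧ x t₀ = x₀ ∧ x T = x₁

/-- The control system `ẋ = F x u` is controllable: every state can be steered to every state. -/
def IsControllable {X U : Type*} [NormedAddCommGroup X] [NormedSpace ℝ X] [NormedAddCommGroup U]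
    (F : X → U → X) : Prop :=
  ∀ (t₀ : ℝ) (x₀ x₁ : X), CanSteer F t₀ x₀ x₁

/-- The single-input pair `(A, b)` is controllable: the system `ẋ = A x + b u` is controllable. -/
def PairControllable {m : ℕ} (A : Matrix (Fin m) (Fin m) ℝ) (b : Fin m → ℝ) : Prop :=
  IsControllable (fun (x : Fin m → ℝ) (u : ℝ) => A *ᵥ x + u • b)

/-- The matrix `[0, I; α₁, α₂ … α_m]`: ones on the superdiagonal, last row `α`, zero elsewhere. -/
def companionForm {m : ℕ} (α : Fin m → ℝ) : Matrix (Fin m) (Fin m) ℝ :=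
  Matrix.of fun p q =>
    if (p : ℕ) + 1 = m then α q else if (q : ℕ) = (p : ℕ) + 1 then 1 else 0

/-- The last standard basis vector `(0, …, 0, 1)ᵀ`. -/
def lastVector (m : ℕ) : Fin m → ℝ := fun p => if (p : ℕ) + 1 = m then 1 else 0

/-- The coordinate change `x ↦ T x` brings `ẋ = A x + b u` into controllable canonical form, and
`α` is the last row of the transformed state matrix. -/
def IsCanonicalForm {m : ℕ} (A : Matrix (Fin m) (Fin m) ℝ) (b : Fin m → ℝ)
    (T : Matrix (Fin m) (Fin m) ℝ) (α : Fin m → ℝ) : Prop :=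
  IsUnit T.det ∧ T * A * T⁻¹ = companionForm α ∧ T *ᵥ b = lastVector m

/-- An undirected graph with a symmetric positive weight on each edge; the weight of a non-edge
is `0`, so that `weight` is the adjacency matrix. -/
structure WeightedGraph (V : Type*) where
  graph : SimpleGraph V
  weight : V → V → ℝ
  weight_symm : ∀ i j, weight i j = weight j i
  weight_pos : ∀ i j, graph.Adj i j → 0 < weight i j
  weight_zero : ∀ i j, ¬ graph.Adj i j → weight i j = 0

/-- Each connected component of the interconnection graph contains at least one leader. -/
def LeaderFollowerConnected {V : Type*} (G : WeightedGraph V) (leaders : Finset V) : Prop :=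
  ∀ c : G.graph.ConnectedComponent, ∃ v ∈ leaders, G.graph.connectedComponentMk v = c

/-- The external control `u_{oi}` received by agent `i`, which is `0` if `i` is a follower. -/
def externalInput {n : ℕ} (leaders : Finset (Fin n)) (v : {i // i ∈ leaders} → ℝ) (i : Fin n) : ℝ :=
  if h : i ∈ leaders then v ⟨i, h⟩ else 0

/-- The distributed protocol
`u_i = - α_iᵀ T_i x_i + ∑_{j ∈ N_i} a_{ij} (β_jᵀ T_j x_j - β_iᵀ T_i x_i) + u_{oi}`.
The sum may run over all `j` because `a_{ij} = 0` when `j` is not a neighbor of `i`. -/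
def protocol {n : ℕ} {m : Fin n → ℕ} (T : ∀ i, Matrix (Fin (m i)) (Fin (m i)) ℝ)
    (α : ∀ i, Fin (m i) → ℝ) (G : WeightedGraph (Fin n)) (leaders : Finset (Fin n))
    (β : ∀ i, Fin (m i) → ℝ)
    (x : ∀ i, Fin (m i) → ℝ) (v : {i // i ∈ leaders} → ℝ) (i : Fin n) : ℝ :=
  - (α i ⬝ᵥ (T i *ᵥ x i))
    + ∑ j, G.weight i j * (β j ⬝ᵥ (T j *ᵥ x j) - β i ⬝ᵥ (T i *ᵥ x i))
    + externalInput leaders v i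

/-- The closed-loop network `ẋ_i = A_i x_i + b_i u_i`, `i = 1, …, n`, under the protocol, whose
input is the external control of the leaders. -/
def networkField {n : ℕ} {m : Fin n → ℕ} (A : ∀ i, Matrix (Fin (m i)) (Fin (m i)) ℝ)
    (b : ∀ i, Fin (m i) → ℝ) (T : ∀ i, Matrix (Fin (m i)) (Fin (m i)) ℝ)
    (α : ∀ i, Fin (m i) → ℝ) (G : WeightedGraph (Fin n)) (leaders : Finset (Fin n))
    (β : ∀ i, Fin (m i) → ℝ)
    (x : ∀ i, Fin (m i) → ℝ) (v : {i // i ∈ leaders} → ℝ) : ∀ i, Fin (m i) → ℝ :=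
  fun i => A i *ᵥ x i + protocol T α G leaders β x v i • b i

/-- The network is controllable: for any initial state and any target state there are a finite
time, an external control and feedback gains `β_i` that steer the former to the latter. -/
def NetworkControllable {n : ℕ} {m : Fin n → ℕ} (A : ∀ i, Matrix (Fin (m i)) (Fin (m i)) ℝ)
    (b : ∀ i, Fin (m i) → ℝ) (T : ∀ i, Matrix (Fin (m i)) (Fin (m i)) ℝ)
    (α : ∀ i, Fin (m i) → ℝ) (G : WeightedGraph (Fin n)) (leaders : Finset (Fin n)) : Prop :=
  ∀ (t₀ : ℝ) (x₀ x₁ : ∀ i, Fin (m i) → ℝ), ∃ β : ∀ i, Fin (m i) → ℝ,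
    CanSteer (networkField A b T α G leaders β) t₀ x₀ x₁

/-- One choice of the gains `β_i`, the same for all pairs of states, makes the closed-loop network
controllable. -/
def NetworkControllableUniformGains {n : ℕ} {m : Fin n → ℕ}
    (A : ∀ i, Matrix (Fin (m i)) (Fin (m i)) ℝ)
    (b : ∀ i, Fin (m i) → ℝ) (T : ∀ i, Matrix (Fin (m i)) (Fin (m i)) ℝ)
    (α : ∀ i, Fin (m i) → ℝ) (G : WeightedGraph (Fin n)) (leaders : Finset (Fin n)) : Prop :=
  ∃ β : ∀ i, Fin (m i) → ℝ, IsControllable (networkField A b T α G leaders β)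

/-!
Necessity. In a controllable network the protocol of agent `i` is itself an admissible input of the
pair `(A i, b i)`, so every agent is controllable. A connected component without a leader evolves
autonomously and linearly, so by uniqueness of solutions it stays at `0` once it is there.

Sufficiency. In canonical coordinates `z i = T i *ᵥ x i` the feedback `-α iᵀ T i x i` turns each
agent into a chain of `m i` integrators. Take the gains `β i = (c i, 0, …, 0)`, the same for all
pairs of states. By the Hautus test (`isControllable_of_hautus`) it is enough that no complex left
eigenvector of the closed-loop network vanishes on the inputs of the leaders. Going down the chains,
such an eigenvector for the eigenvalue `μ` is determined by its last entries `q i`, which satisfy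
`μ ^ m i * q i = c i * ∑ j, a i j * (q j - q i)`, with `q i = 0` for the leaders
(`canonicalField_left_eigenvector`).

This has no nonzero solution if the `c i` are algebraically independent over the field generated by
the weights `a i j` (`eq_zero_of_spectral_equation`). For `μ = 0`, `q` is in the kernel of the
Laplacian, hence constant on components, each of which contains a leader. For `μ ≠ 0`, let `S` be the
support of `q`. The equations at the vertices of `S` give `c i`, `i ∈ S`, as rational functions of
`μ` and of the ratios of the `q j`, `j ∈ S`; since some edge joins `S` to its complement, the
equation at its outer end is a nontrivial linear relation between those ratios. So `#S`
algebraically independent numbers would lie in a field generated by `#S - 1` elements. Such `c i`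
exist because the weights generate a countable field (`exists_algebraicIndependent_real`).
-/

/-! ### Linear control systems -/

section Hautus

variable {X U : Type*} [NormedAddCommGroup X] [NormedSpace ℝ X]

/-- The flow `exp (t M)` of the linear differential equation `ẋ = M x`. -/
noncomputable def linearFlow (M : X →L[ℝ] X) (t : ℝ) : X →L[ℝ] X := NormedSpace.exp (t • M)

theorem linearFlow_zero (M : X →L[ℝ] X) : linearFlow M 0 = 1 := by
  simp [linearFlow]

variable [FiniteDimensional ℝ X] [NormedAddCommGroup U] [NormedSpace ℝ U]

theorem linearFlow_add (M : X →L[ℝ] X) (s t : ℝ) :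
    linearFlow M (s + t) = linearFlow M s * linearFlow M t := by
  have : CompleteSpace X := FiniteDimensional.complete ℝ X
  rw [linearFlow, linearFlow, linearFlow, add_smul]
  exact NormedSpace.exp_add_of_commute_of_mem_ball (𝕂 := ℝ)
    (((Commute.refl M).smul_left s).smul_right t)
    ((NormedSpace.expSeries_radius_eq_top ℝ (X →L[ℝ] X)).symm ▸ edist_lt_top _ _)
    ((NormedSpace.expSeries_radius_eq_top ℝ (X →L[ℝ] X)).symm ▸ edist_lt_top _ _)

theorem hasDerivAt_linearFlow (M : X →L[ℝ] X) (t : ℝ) :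
    HasDerivAt (linearFlow M) (linearFlow M t * M) t := by
  have : CompleteSpace X := FiniteDimensional.complete ℝ X
  exact hasDerivAt_exp_smul_const M t

theorem hasDerivAt_linearFlow' (M : X →L[ℝ] X) (t : ℝ) :
    HasDerivAt (linearFlow M) (M * linearFlow M t) t := by
  have : CompleteSpace X := FiniteDimensional.complete ℝ X
  exact hasDerivAt_exp_smul_const' M t

theorem continuous_linearFlow (M : X →L[ℝ] X) : Continuous (linearFlow M) :=
  continuous_iff_continuousAt.2 fun t => (hasDerivAt_linearFlow M t).continuousAt

/-- Variation of constants: a continuous input `v` drives the state `linearFlow M (t₀ - τ) y` at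
time `t₀` along the displayed curve. -/
theorem isTrajectory_variation_of_constants (M : X →L[ℝ] X) (B : U →L[ℝ] X) (t₀ T τ : ℝ) (y : X)
    {v : ℝ → U} (hv : Continuous v) :
    IsTrajectory (fun x u => M x + B u) t₀ T v fun t =>
      linearFlow M (t - τ) (y + ∫ s in t₀..t, linearFlow M (τ - s) (B (v s))) := by
  have : CompleteSpace X := FiniteDimensional.complete ℝ X
  have hk : Continuous fun s => linearFlow M (τ - s) (B (v s)) :=
    ((continuous_linearFlow M).comp (continuous_const.sub continuous_id)).clm_apply
      (B.continuous.comp hv)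
  have hder : ∀ t, HasDerivAt (fun t =>
      linearFlow M (t - τ) (y + ∫ s in t₀..t, linearFlow M (τ - s) (B (v s))))
      (M (linearFlow M (t - τ) (y + ∫ s in t₀..t, linearFlow M (τ - s) (B (v s)))) + B (v t))
      t := by
    intro t
    have h1 : HasDerivAt (fun t => linearFlow M (t - τ)) (M * linearFlow M (t - τ)) t := by
      exact (hasDerivAt_linearFlow' M (t - τ)).comp_sub_const t τ
    have h2 : HasDerivAt (fun t => y + ∫ s in t₀..t, linearFlow M (τ - s) (B (v s)))
        (linearFlow M (τ - t) (B (v t))) t :=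
      (intervalIntegral.integral_hasDerivAt_right (hk.intervalIntegrable _ _)
        hk.stronglyMeasurable.stronglyMeasurableAtFilter hk.continuousAt).const_add y
    have h3 : linearFlow M (t - τ) (linearFlow M (τ - t) (B (v t))) = B (v t) := by
      rw [← mul_apply_eq_comp, ← linearFlow_add]
      simp [linearFlow_zero]
    simpa [h3] using h1.clm_apply h2
  have hc := continuous_iff_continuousAt.2 fun t => (hder t).continuousAt
  refine ⟨hv.intervalIntegrable _ _, hc.continuousOn, fun t _ => ?_⟩
  rw [intervalIntegral.integral_eq_sub_of_hasDerivAt (fun s _ => hder s)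
    (((M.continuous.comp hc).add (B.continuous.comp hv)).intervalIntegrable _ _)]
  abel

/-- The states `∫ exp ((t₀ + 1 - s) M) B v(s) ds`, over `[t₀, t₀ + 2]`, for continuous `v`. Up to
the invertible factor `exp M` they are the states reachable from `0` in time `2`. -/
noncomputable def reachableSubspace (M : X →L[ℝ] X) (B : U →L[ℝ] X) (t₀ : ℝ) : Submodule ℝ X where
  carrier := {y | ∃ v : ℝ → U, Continuous v ∧
    ∫ s in t₀..(t₀ + 2), linearFlow M (t₀ + 1 - s) (B (v s)) = y}
  zero_mem' := ⟨fun _ => 0, continuous_const, by simp⟩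
  add_mem' := by
    rintro _ _ ⟨v, hv, rfl⟩ ⟨w, hw, rfl⟩
    have hk : ∀ v : ℝ → U, Continuous v →
        Continuous fun s => linearFlow M (t₀ + 1 - s) (B (v s)) := fun v hv =>
      ((continuous_linearFlow M).comp (continuous_const.sub continuous_id)).clm_apply
        (B.continuous.comp hv)
    refine ⟨fun s => v s + w s, hv.add hw, ?_⟩
    rw [← intervalIntegral.integral_add ((hk v hv).intervalIntegrable _ _)
      ((hk w hw).intervalIntegrable _ _)]
    simp
  smul_mem' := by
    rintro c _ ⟨v, hv, rfl⟩
    refine ⟨fun s => c • v s, hv.const_smul c, ?_⟩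
    simp [intervalIntegral.integral_smul]

/-- A functional vanishing on `reachableSubspace` vanishes along the orbits `exp (t M) B u`, as one
sees by testing it against the input `s ↦ g(s) u` where `g(s) = φ (exp ((t₀ + 1 - s) M) B u)`. -/
theorem apply_linearFlow_eq_zero_of_reachableSubspace_le_ker (M : X →L[ℝ] X) (B : U →L[ℝ] X)
    (t₀ : ℝ) (φ : X →ₗ[ℝ] ℝ) (hφ : reachableSubspace M B t₀ ≤ LinearMap.ker φ) (u : U) {t : ℝ}
    (ht : t ∈ Icc (-1 : ℝ) 1) : φ (linearFlow M t (B u)) = 0 := by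
  have : CompleteSpace X := FiniteDimensional.complete ℝ X
  set φ' : X →L[ℝ] ℝ := LinearMap.toContinuousLinearMap φ with hφ'
  have hφφ : ∀ x, φ x = φ' x := fun x => rfl
  set g : ℝ → ℝ := fun s => φ' (linearFlow M (t₀ + 1 - s) (B u)) with hg
  have hk : Continuous fun s => linearFlow M (t₀ + 1 - s) (B u) :=
    ((continuous_linearFlow M).comp (continuous_const.sub continuous_id)).clm_apply
      continuous_const
  have hgc : Continuous g := φ'.continuous.comp hk
  have h0 : ∫ s in t₀..(t₀ + 2), g s * g s = 0 := by
    have h := hφ (x := ∫ s in t₀..(t₀ + 2), linearFlow M (t₀ + 1 - s) (B (g s • u)))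
      ⟨fun s => g s • u, hgc.smul continuous_const, rfl⟩
    rw [LinearMap.mem_ker, hφφ, ← ContinuousLinearMap.intervalIntegral_comp_comm] at h
    · simpa using h
    · have h1 : Continuous fun s => g s • linearFlow M (t₀ + 1 - s) (B u) := hgc.smul hk
      simpa using h1.intervalIntegrable (μ := volume) t₀ (t₀ + 2)
  by_contra hne
  have hpos : 0 < ∫ s in t₀..(t₀ + 2), g s * g s := by
    refine intervalIntegral.integral_pos (by linarith) (hgc.mul hgc).continuousOn
      (fun s _ => mul_self_nonneg _) ⟨t₀ + 1 - t, ⟨by linarith [ht.2], by linarith [ht.1]⟩, ?_⟩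
    refine mul_self_pos.2 ?_
    simpa [hg, hφφ] using hne
  exact hpos.ne' h0

/-- The Hautus test: the linear system `ẋ = M x + B u` is controllable if no complex left
eigenvector `p` of `M` annihilates `B`. Left eigenvectors are encoded as real-linear functionals
`p : X → ℂ`, which form a complex vector space. -/
theorem isControllable_of_hautus (M : X →L[ℝ] X) (B : U →L[ℝ] X)
    (h : ∀ (p : X →ₗ[ℝ] ℂ) (μ : ℂ), (∀ x, p (M x) = μ * p x) → (∀ u, p (B u) = 0) → p = 0) :
    IsControllable fun x u => M x + B u := by
  have : CompleteSpace X := FiniteDimensional.complete ℝ X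
  intro t₀ x₀ x₁
  -- `N` consists of the complex functionals vanishing along the orbits of the columns of `B`; it is
  -- invariant under the transpose of `M`, so that it contains an eigenvector unless it is trivial.
  let N : Submodule ℂ (X →ₗ[ℝ] ℂ) :=
    { carrier := {p | ∀ t ∈ Ioo (-1 : ℝ) 1, ∀ u, p (linearFlow M t (B u)) = 0}
      zero_mem' := fun _ _ _ => rfl
      add_mem' := fun {p q} hp hq t ht u => by simp [hp t ht u, hq t ht u]
      smul_mem' := fun c p hp t ht u => by simp [hp t ht u] }
  let F : Module.End ℂ (X →ₗ[ℝ] ℂ) :=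
    { toFun := fun p => p ∘ₗ (M : X →ₗ[ℝ] X)
      map_add' := fun p q => rfl
      map_smul' := fun c p => rfl }
  have hF : ∀ p ∈ N, F p ∈ N := by
    intro p hp t ht u
    have h1 : HasDerivAt (fun t => linearFlow M t (B u)) (M (linearFlow M t (B u))) t := by
      simpa using (hasDerivAt_linearFlow' M t).clm_apply (hasDerivAt_const t (B u))
    have h2 := (LinearMap.toContinuousLinearMap p).hasFDerivAt.comp_hasDerivAt t h1
    have h3 : HasDerivAt (fun _ : ℝ => (0 : ℂ)) 0 t := hasDerivAt_const t 0
    refine h2.unique (h3.congr_of_eventuallyEq ?_)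
    filter_upwards [Ioo_mem_nhds ht.1 ht.2] with s hs using hp s hs u
  have hN : N = ⊥ := by
    by_contra hne
    have : Nontrivial N := Submodule.nontrivial_iff_ne_bot.2 hne
    obtain ⟨μ, hμ⟩ := Module.End.exists_eigenvalue (F.restrict hF)
    obtain ⟨p, hp⟩ := hμ.exists_hasEigenvector
    refine hp.2 (Subtype.ext (h p μ (fun x => ?_) fun u => ?_))
    · have := congrArg (fun q : N => (q : X →ₗ[ℝ] ℂ) x) hp.apply_eq_smul
      have h1 : F p x = μ * (p : X →ₗ[ℝ] ℂ) x := by simpa using this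
      exact h1
    · simpa [linearFlow_zero] using p.2 0 (by norm_num) u
  have hR : reachableSubspace M B t₀ = ⊤ := by
    by_contra hne
    obtain ⟨φ, hφ0, hφ⟩ := Submodule.exists_le_ker_of_lt_top _ (lt_top_iff_ne_top.2 hne)
    have hmem : Complex.ofRealCLM.toLinearMap ∘ₗ φ ∈ N := fun t ht u => by
      simpa using
        apply_linearFlow_eq_zero_of_reachableSubspace_le_ker M B t₀ φ hφ u (Ioo_subset_Icc_self ht)
    rw [hN, Submodule.mem_bot] at hmem
    refine hφ0 (LinearMap.ext fun x => ?_)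
    simpa using LinearMap.congr_fun hmem x
  obtain ⟨v, hv, hvy⟩ : linearFlow M (-1) x₁ - linearFlow M 1 x₀ ∈ reachableSubspace M B t₀ :=
    hR ▸ Submodule.mem_top
  refine ⟨t₀ + 2, by linarith, v, _,
    isTrajectory_variation_of_constants M B t₀ (t₀ + 2) (t₀ + 1) (linearFlow M 1 x₀) hv, ?_, ?_⟩
  · simp only [intervalIntegral.integral_same, add_zero]
    rw [← mul_apply_eq_comp, ← linearFlow_add]
    simp [linearFlow_zero]
  · simp only [hvy, add_sub_cancel]
    rw [← mul_apply_eq_comp, ← linearFlow_add]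
    norm_num [linearFlow_zero]

end Hautus

/-! ### Algebraically independent gains -/

/-- Over a countable subfield of `ℂ` there are arbitrarily many algebraically independent real
numbers. -/
theorem exists_algebraicIndependent_real {ι : Type*} [Finite ι] (K : Subfield ℂ)
    (hK : Cardinal.mk K ≤ Cardinal.aleph0) :
    ∃ c : ι → ℝ, AlgebraicIndependent K fun i => (c i : ℂ) := by
  let S : Set ℂ := range ((↑) : ℝ → ℂ)
  -- The complex numbers are algebraic over the real ones, so the latter contain a transcendence
  -- basis of `ℂ` over `K`, which is infinite for reasons of cardinality.
  have hreal : ∀ x : ℝ, (x : ℂ) ∈ Algebra.adjoin K S := fun x =>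
    Algebra.subset_adjoin ⟨x, rfl⟩
  have halg : Algebra.IsAlgebraic (Algebra.adjoin K S) ℂ := by
    refine ⟨fun z => ?_⟩
    let r : Algebra.adjoin K S := ⟨((2 * z.re : ℝ) : ℂ), hreal _⟩
    let s : Algebra.adjoin K S := ⟨((z.re ^ 2 + z.im ^ 2 : ℝ) : ℂ), hreal _⟩
    refine ⟨Polynomial.X ^ 2 - Polynomial.C r * Polynomial.X + Polynomial.C s, ?_, ?_⟩
    · intro h
      have := congrArg (fun p => Polynomial.coeff p 2) h
      simp at this
    · have hr : algebraMap (Algebra.adjoin K S) ℂ r = ((2 * z.re : ℝ) : ℂ) := rfl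
      have hs : algebraMap (Algebra.adjoin K S) ℂ s = ((z.re ^ 2 + z.im ^ 2 : ℝ) : ℂ) := rfl
      simp only [map_add, map_sub, map_mul, map_pow, Polynomial.aeval_X, Polynomial.aeval_C, hr, hs]
      apply Complex.ext <;> simp [pow_two] <;> ring
  obtain ⟨t, htS, ht⟩ := exists_isTranscendenceBasis_subset (R := K) S
  have hcard := IsAlgClosed.cardinal_eq_cardinal_transcendence_basis_of_aleph0_lt' _ ht hK
    (by rw [Cardinal.mk_complex]; exact Cardinal.aleph0_lt_continuum)
  have hinf : Infinite t := by
    rw [Cardinal.infinite_iff, ← hcard, Cardinal.mk_complex]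
    exact Cardinal.aleph0_le_continuum
  obtain ⟨e⟩ : Nonempty (ι ↪ t) := by
    obtain ⟨k, ⟨f⟩⟩ := Finite.exists_equiv_fin ι
    exact ⟨(f.toEmbedding.trans Fin.valEmbedding).trans (Infinite.natEmbedding t)⟩
  choose c hc using fun i => htS (e i).2
  refine ⟨c, ?_⟩
  simp only [hc]
  exact ht.1.comp e e.injective

/-- A field extension contains no more algebraically independent elements than it has generators. -/
theorem AlgebraicIndependent.card_le_of_mem_adjoin {K E ι : Type*} [Field K] [Field E] [Algebra K E]
    [Fintype ι] {c : ι → E} (hc : AlgebraicIndependent K c) (s : Finset E)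
    (h : ∀ i, c i ∈ IntermediateField.adjoin K (s : Set E)) : Fintype.card ι ≤ s.card := by
  have hsub : range c ⊆ (AlgebraicIndependent.matroid K E).closure (s : Set E) := by
    rintro _ ⟨i, rfl⟩
    rw [AlgebraicIndependent.matroid_closure_eq, SetLike.mem_coe, Subalgebra.mem_algebraicClosure]
    have hi := h i
    generalize c i = z at hi
    induction hi using IntermediateField.adjoin_induction with
    | mem x hx => exact isAlgebraic_algebraMap (⟨x, Algebra.subset_adjoin hx⟩ :
        Algebra.adjoin K (s : Set E))
    | algebraMap x => exact isAlgebraic_algebraMap (algebraMap K (Algebra.adjoin K (s : Set E)) x)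
    | add x y _ _ hx hy => exact hx.add hy
    | inv x _ hx => exact hx.inv
    | mul x y _ _ hx hy => exact hx.mul hy
  have hind := AlgebraicIndependent.matroid_indep_iff.2 hc.to_subtype_range
  have hle : (range c).encard ≤ (s : Set E).encard := by
    rw [← hind.eRk_eq_encard]
    exact ((Matroid.eRk_mono _ hsub).trans_eq (Matroid.eRk_closure_eq _ _)).trans
      (Matroid.eRk_le_encard _ _)
  rw [← image_univ, hc.injective.encard_image, encard_coe_eq_coe_finsetCard, encard_univ,
    ENat.card_eq_coe_fintype_card] at hle
  exact_mod_cast hle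

/-! ### The spectral equation of the network -/

section Spectral

variable {V : Type*}

/-- A set that contains a vertex but no leader has an edge leaving it. -/
theorem LeaderFollowerConnected.exists_boundary_edge {G : WeightedGraph V} {leaders : Finset V}
    (hG : LeaderFollowerConnected G leaders) (S : Set V) {u : V} (hu : u ∈ S)
    (hS : ∀ l ∈ leaders, l ∉ S) : ∃ i j, G.graph.Adj i j ∧ i ∉ S ∧ j ∈ S := by
  obtain ⟨l, hl, hlu⟩ := hG (G.graph.connectedComponentMk u)
  obtain ⟨p⟩ := (SimpleGraph.ConnectedComponent.exact hlu).symm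
  obtain ⟨d, -, hd1, hd2⟩ := p.exists_boundary_dart S hu (hS l hl)
  exact ⟨d.snd, d.fst, d.adj.symm, hd2, hd1⟩

variable [Fintype V]

/-- A function in the kernel of the weighted graph Laplacian takes the same value at adjacent
vertices, because the Laplacian is the symmetric form `∑ aᵢⱼ |qᵢ - qⱼ|²`. -/
theorem WeightedGraph.eq_of_adj_of_laplacian_eq_zero (G : WeightedGraph V) {q : V → ℂ}
    (hq : ∀ i, ∑ j, (G.weight i j : ℂ) * (q j - q i) = 0) {i j : V} (hij : G.graph.Adj i j) :
    q i = q j := by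
  have h1 : ∑ i, ∑ j, (G.weight i j : ℂ) * (starRingEnd ℂ (q i) * (q j - q i)) = 0 := by
    refine Finset.sum_eq_zero fun i _ => ?_
    rw [← mul_zero (starRingEnd ℂ (q i)), ← hq i, Finset.mul_sum]
    exact Finset.sum_congr rfl fun j _ => by ring
  have h2 : ∑ i, ∑ j, (G.weight i j : ℂ) * (starRingEnd ℂ (q j) * (q i - q j)) = 0 := by
    rw [Finset.sum_comm, ← h1]
    exact Finset.sum_congr rfl fun i _ => Finset.sum_congr rfl fun j _ => by
      rw [G.weight_symm]
  have h3 : ∑ i, ∑ j, G.weight i j * Complex.normSq (q i - q j) = 0 := by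
    have h : ((∑ i, ∑ j, G.weight i j * Complex.normSq (q i - q j) : ℝ) : ℂ) = 0 := by
      rw [← neg_eq_zero]
      refine Eq.trans ?_ ((congrArg₂ (· + ·) h1 h2).trans (add_zero 0))
      push_cast
      rw [← Finset.sum_add_distrib, ← Finset.sum_neg_distrib]
      refine Finset.sum_congr rfl fun i _ => ?_
      rw [← Finset.sum_add_distrib, ← Finset.sum_neg_distrib]
      refine Finset.sum_congr rfl fun j _ => ?_
      rw [Complex.normSq_eq_conj_mul_self, map_sub]
      ring
    exact_mod_cast h
  have hnn : ∀ i j, 0 ≤ G.weight i j * Complex.normSq (q i - q j) := fun i j => by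
    refine mul_nonneg ?_ (Complex.normSq_nonneg _)
    by_cases h : G.graph.Adj i j
    · exact (G.weight_pos i j h).le
    · exact (G.weight_zero i j h).ge
  have h4 := (Finset.sum_eq_zero_iff_of_nonneg fun i _ =>
    Finset.sum_nonneg fun j _ => hnn i j).1 h3 i (Finset.mem_univ i)
  have h5 := (Finset.sum_eq_zero_iff_of_nonneg fun j _ => hnn i j).1 h4 j (Finset.mem_univ j)
  rcases mul_eq_zero.1 h5 with h | h
  · exact absurd h (G.weight_pos i j hij).ne'
  · exact sub_eq_zero.1 (Complex.normSq_eq_zero.1 h)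

/-- For gains `c` that are algebraically independent over the field of the weights, the spectral
equation of the network has no nonzero solution vanishing at the leaders. For `μ ≠ 0`, let `S` be
the support of a solution. The equation at the vertices of `S` expresses the gains on `S` through
`μ` and the ratios of the `q j`, `j ∈ S`, and the equation at a vertex outside `S` with a neighbor
in `S` is a linear relation between these ratios. So `#S` independent gains would lie in a field
with `#S - 1` generators. -/
theorem eq_zero_of_spectral_equation {G : WeightedGraph V} {leaders : Finset V}
    (hG : LeaderFollowerConnected G leaders) {K : Subfield ℂ}
    (hK : ∀ i j, (G.weight i j : ℂ) ∈ K) {c : V → ℝ}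
    (hc : AlgebraicIndependent K fun i => (c i : ℂ)) {m : V → ℕ} (hm : ∀ i, 0 < m i)
    {μ : ℂ} {q : V → ℂ}
    (hq : ∀ i, μ ^ m i * q i = c i * ∑ j, (G.weight i j : ℂ) * (q j - q i))
    (hl : ∀ i ∈ leaders, q i = 0) : q = 0 := by
  classical
  by_contra hne
  obtain ⟨u, hu⟩ := Function.ne_iff.1 hne
  obtain ⟨i₀, j₀, hadj, hi₀, hj₀⟩ := hG.exists_boundary_edge {v | q v ≠ 0} (u := u) hu
    fun l h h' => h' (hl l h)
  have hi₀ : q i₀ = 0 := not_not.1 hi₀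
  have hj₀ : q j₀ ≠ 0 := hj₀
  have hc0 : ∀ i, (c i : ℂ) ≠ 0 := fun i => hc.ne_zero i
  by_cases hμ : μ = 0
  · refine hj₀ ?_
    rw [← hi₀]
    refine (G.eq_of_adj_of_laplacian_eq_zero (fun i => ?_) hadj).symm
    have h := hq i
    rw [hμ, zero_pow (hm i).ne', zero_mul, eq_comm] at h
    exact (mul_eq_zero.1 h).resolve_left (hc0 i)
  have ha : (G.weight i₀ j₀ : ℂ) ≠ 0 := by exact_mod_cast (G.weight_pos _ _ hadj).ne'
  have hrel : ∑ j, (G.weight i₀ j : ℂ) * q j = 0 := by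
    have h := hq i₀
    simp only [hi₀, mul_zero, sub_zero] at h
    exact (mul_eq_zero.1 h.symm).resolve_left (hc0 i₀)
  obtain ⟨j₁, hj₁, hj₁₀⟩ : ∃ j₁, q j₁ ≠ 0 ∧ j₁ ≠ j₀ := by
    by_contra! h
    rw [Finset.sum_eq_single j₀ (fun j _ hj => by rw [not_not.1 (mt (h j) hj), mul_zero])
      (by simp)] at hrel
    exact mul_ne_zero ha hj₀ hrel
  set r : V → ℂ := fun j => q j / q j₁ with hr
  let S : Finset V := Finset.univ.filter fun j => q j ≠ 0
  -- The generators are the ratios `r j` for `j ≠ j₀, j₁` in `S`; since `r j₁ = 1`, the place of `j₁`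
  -- is free for `μ`.
  let g : V → ℂ := fun j => if j = j₁ then μ else r j
  let F := IntermediateField.adjoin K (((S.erase j₀).image g : Finset ℂ) : Set ℂ)
  have hgF : ∀ j, q j ≠ 0 → j ≠ j₀ → g j ∈ F := fun j hj hj' =>
    IntermediateField.subset_adjoin _ _ (by
      rw [Finset.mem_coe]
      exact Finset.mem_image_of_mem g (by simp [S, hj, hj']))
  have hμF : μ ∈ F := by simpa [g] using hgF j₁ hj₁ hj₁₀
  have haF : ∀ i j, (G.weight i j : ℂ) ∈ F := fun i j => F.algebraMap_mem ⟨_, hK i j⟩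
  have hrF' : ∀ j, j ≠ j₀ → r j ∈ F := by
    intro j hj
    by_cases hj1 : j = j₁
    · simp [hr, hj1, hj₁]
    by_cases hqj : q j = 0
    · simp [hr, hqj]
    · simpa [g, hj1] using hgF j hqj hj
  have hrF : ∀ j, r j ∈ F := by
    intro j
    by_cases hj : j = j₀
    · have hrel' : (G.weight i₀ j₀ : ℂ) * r j₀ +
          ∑ j ∈ Finset.univ.erase j₀, (G.weight i₀ j : ℂ) * r j = 0 := by
        rw [Finset.add_sum_erase _ (fun j => (G.weight i₀ j : ℂ) * r j) (Finset.mem_univ j₀)]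
        simp only [hr, ← mul_div_assoc, ← Finset.sum_div, hrel, zero_div]
      have h : r j₀ = -(∑ j ∈ Finset.univ.erase j₀, (G.weight i₀ j : ℂ) * r j) /
          (G.weight i₀ j₀ : ℂ) := by
        rw [eq_div_iff ha]
        linear_combination hrel'
      rw [hj, h]
      exact F.div_mem (F.neg_mem (F.sum_mem fun j hj =>
        F.mul_mem (haF _ _) (hrF' j (Finset.ne_of_mem_erase hj)))) (haF _ _)
    · exact hrF' j hj
  have hcF : ∀ i : S, (c i : ℂ) ∈ F := by
    rintro ⟨i, hi⟩
    have hqi : q i ≠ 0 := by simpa [S] using hi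
    have h : (c i : ℂ) * ∑ j, (G.weight i j : ℂ) * (r j - r i) = μ ^ m i * r i := by
      have : ∑ j, (G.weight i j : ℂ) * (r j - r i) =
          (∑ j, (G.weight i j : ℂ) * (q j - q i)) / q j₁ := by
        rw [Finset.sum_div]
        exact Finset.sum_congr rfl fun j _ => by simp only [hr]; ring
      rw [this, ← mul_div_assoc, ← hq i]
      simp only [hr]
      ring
    have hΔ : ∑ j, (G.weight i j : ℂ) * (r j - r i) ≠ 0 := by
      intro h0
      rw [h0, mul_zero] at h
      exact mul_ne_zero (pow_ne_zero _ hμ) (div_ne_zero hqi hj₁) h.symm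
    change (c i : ℂ) ∈ F
    rw [eq_div_of_mul_eq hΔ h]
    exact F.div_mem (F.mul_mem (pow_mem hμF _) (hrF i))
      (F.sum_mem fun j _ => F.mul_mem (haF _ _) (F.sub_mem (hrF j) (hrF i)))
  have hcard := (hc.comp ((↑) : S → V) Subtype.val_injective).card_le_of_mem_adjoin _ hcF
  have hj₀S : j₀ ∈ S := by simp [S, hj₀]
  have h1 := Finset.card_image_le (s := S.erase j₀) (f := g)
  have h2 := Finset.card_erase_lt_of_mem hj₀S
  rw [Fintype.card_coe] at hcard
  omega

end Spectral

/-! ### Trajectories of linear systems -/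

section Trajectories

variable {X U Y : Type*} [NormedAddCommGroup X] [NormedSpace ℝ X] [NormedAddCommGroup U]
  [NormedSpace ℝ U] [NormedAddCommGroup Y] [NormedSpace ℝ Y]

theorem IsTrajectory.intervalIntegrable_clm {F : X → U → X} {t₀ T : ℝ} {u : ℝ → U} {x : ℝ → X}
    (h : IsTrajectory F t₀ T u x) (hT : t₀ ≤ T) (L : X × U →L[ℝ] Y) :
    IntervalIntegrable (fun s => L (x s, u s)) volume t₀ T := by
  have hx : IntervalIntegrable x volume t₀ T := h.2.1.intervalIntegrable_of_Icc hT
  have h1 : IntervalIntegrable (fun s => L.comp (.inl ℝ X U) (x s) + L.comp (.inr ℝ X U) (u s))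
      volume t₀ T :=
    .add ⟨ContinuousLinearMap.integrable_comp _ hx.1, ContinuousLinearMap.integrable_comp _ hx.2⟩
      ⟨ContinuousLinearMap.integrable_comp _ h.1.1, ContinuousLinearMap.integrable_comp _ h.1.2⟩
  refine h1.congr fun s _ => ?_
  simp [← map_add]

/-- The image of a trajectory of a linear system under a linear map satisfies the image of the
integral equation. -/
theorem IsTrajectory.clm_apply_eq [FiniteDimensional ℝ X] [FiniteDimensional ℝ Y]
    {L : X × U →L[ℝ] X} {t₀ T : ℝ} {u : ℝ → U} {x : ℝ → X}
    (h : IsTrajectory (fun x u => L (x, u)) t₀ T u x) (Φ : X →L[ℝ] Y) {t : ℝ}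
    (ht : t ∈ Icc t₀ T) : Φ (x t) = Φ (x t₀) + ∫ s in t₀..t, Φ (L (x s, u s)) := by
  have : CompleteSpace X := FiniteDimensional.complete ℝ X
  have : CompleteSpace Y := FiniteDimensional.complete ℝ Y
  have hT : t₀ ≤ T := ht.1.trans ht.2
  have hi := (h.intervalIntegrable_clm hT L).mono_set (uIcc_subset_uIcc_left (by
    rw [uIcc_of_le hT]; exact ht))
  rw [Φ.intervalIntegral_comp_comm hi, ← map_add, ← h.2.2 t ht]

/-- The zero solution is the only one of `ẏ = D y` starting at `0`. -/
theorem eq_zero_of_eq_integral_clm [FiniteDimensional ℝ X] (D : X →L[ℝ] X) {t₀ T : ℝ}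
    {y : ℝ → X} (hy : ContinuousOn y (Icc t₀ T))
    (h : ∀ t ∈ Icc t₀ T, y t = ∫ s in t₀..t, D (y s)) {t : ℝ} (ht : t ∈ Icc t₀ T) : y t = 0 := by
  have : CompleteSpace X := FiniteDimensional.complete ℝ X
  have hT : t₀ ≤ T := ht.1.trans ht.2
  -- Extending `y` continuously to the line makes the integral differentiable everywhere.
  set f : ℝ → X := fun s => D (IccExtend hT ((Icc t₀ T).domRestrict y) s) with hf
  have hfc : Continuous f :=
    D.continuous.comp (continuousOn_iff_continuous_domRestrict.1 hy).Icc_extend'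
  have hfy : ∀ s ∈ Icc t₀ T, f s = D (y s) := fun s hs => by
    simp only [hf, IccExtend_of_mem hT _ hs, domRestrict_apply]
  have hY : ∀ t ∈ Icc t₀ T, y t = ∫ s in t₀..t, f s := fun t ht => by
    rw [h t ht]
    refine intervalIntegral.integral_congr fun s hs => (hfy s ?_).symm
    rw [uIcc_of_le ht.1] at hs
    exact ⟨hs.1, hs.2.trans ht.2⟩
  have hd : ∀ t, HasDerivAt (fun t => ∫ s in t₀..t, f s) (f t) t := fun t =>
    intervalIntegral.integral_hasDerivAt_right (hfc.intervalIntegrable _ _)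
      hfc.stronglyMeasurable.stronglyMeasurableAtFilter hfc.continuousAt
  rw [hY t ht]
  refine eq_zero_of_abs_deriv_le_mul_abs_self_of_eq_zero_right (K := ‖D‖)
    (fun s _ => (hd s).continuousAt.continuousWithinAt) (fun s _ => (hd s).hasDerivWithinAt)
    (by simp) (fun s hs => ?_) t ht
  rw [← hY s (Ico_subset_Icc_self hs), hfy s (Ico_subset_Icc_self hs)]
  exact D.le_opNorm _

end Trajectories

/-! ### Necessity of controllable agents and of leaders in every component -/

section Network

variable {n : ℕ} {m : Fin n → ℕ} (A : ∀ i, Matrix (Fin (m i)) (Fin (m i)) ℝ)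
  (b : ∀ i, Fin (m i) → ℝ) (T : ∀ i, Matrix (Fin (m i)) (Fin (m i)) ℝ)
  (α : ∀ i, Fin (m i) → ℝ) (G : WeightedGraph (Fin n)) (leaders : Finset (Fin n))
  (β : ∀ i, Fin (m i) → ℝ)

/-- The control law of agent `i` as a linear function of the state and the external control. -/
noncomputable def protocolLinearMap (i : Fin n) :
    (∀ i, Fin (m i) → ℝ) × ({i // i ∈ leaders} → ℝ) →ₗ[ℝ] ℝ where
  toFun z := protocol T α G leaders β z.1 z.2 i
  map_add' z w := by
    have h : externalInput leaders (z.2 + w.2) i =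
        externalInput leaders z.2 i + externalInput leaders w.2 i := by
      simp only [externalInput]; split_ifs <;> simp
    simp only [protocol, Prod.fst_add, Prod.snd_add, Pi.add_apply, Matrix.mulVec_add,
      dotProduct_add, h, add_sub_add_comm, mul_add, Finset.sum_add_distrib]
    ring
  map_smul' r z := by
    have h : externalInput leaders (r • z.2) i = r * externalInput leaders z.2 i := by
      simp only [externalInput]; split_ifs <;> simp
    simp only [protocol, Prod.smul_fst, Prod.smul_snd, Pi.smul_apply, Matrix.mulVec_smul,
      dotProduct_smul, h, smul_eq_mul, RingHom.id_apply, ← mul_sub, mul_left_comm _ r,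
      ← Finset.mul_sum]
    ring

/-- The closed-loop network as a continuous linear function of the state and the external
control. -/
noncomputable def networkCLM :
    (∀ i, Fin (m i) → ℝ) × ({i // i ∈ leaders} → ℝ) →L[ℝ] (∀ i, Fin (m i) → ℝ) :=
  LinearMap.toContinuousLinearMap <| LinearMap.pi fun i =>
    (A i).mulVecLin ∘ₗ LinearMap.proj i ∘ₗ LinearMap.fst ℝ _ _ +
      (protocolLinearMap T α G leaders β i).smulRight (b i)

theorem networkCLM_apply (x : ∀ i, Fin (m i) → ℝ) (v : {i // i ∈ leaders} → ℝ) :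
    networkCLM A b T α G leaders β (x, v) = networkField A b T α G leaders β x v := rfl

variable {A b T α G leaders}

/-- In a controllable network each agent is controllable: its protocol is an admissible input. -/
theorem NetworkControllable.pairControllable (h : NetworkControllable A b T α G leaders)
    (i : Fin n) : PairControllable (A i) (b i) := by
  intro t₀ y₀ y₁
  obtain ⟨β, τ, hτ, v, x, hx, hx₀, hx₁⟩ := h t₀ (Pi.single i y₀) (Pi.single i y₁)
  have hx' : IsTrajectory (fun x u => networkCLM A b T α G leaders β (x, u)) t₀ τ v x := hx
  refine ⟨τ, hτ, fun t => protocol T α G leaders β (x t) (v t) i, fun t => x t i,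
    ⟨?_, ?_, fun t ht => ?_⟩, by simp [hx₀], by simp [hx₁]⟩
  · exact hx.intervalIntegrable_clm hτ.le
      (LinearMap.toContinuousLinearMap (protocolLinearMap T α G leaders β i))
  · exact (continuous_apply i).comp_continuousOn hx.2.1
  · exact hx'.clm_apply_eq (ContinuousLinearMap.proj (R := ℝ)
      (φ := fun i => Fin (m i) → ℝ) i) ht

/-- In a controllable network each component has a leader: a component without a leader evolves
autonomously, hence cannot leave the state `0`. -/
theorem NetworkControllable.leaderFollowerConnected (hm : ∀ i, 0 < m i)
    (h : NetworkControllable A b T α G leaders) : LeaderFollowerConnected G leaders := by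
  classical
  intro C
  by_contra! hC
  obtain ⟨i₀, hi₀⟩ := C.exists_rep
  obtain ⟨β, τ, hτ, v, x, hx, hx₀, hx₁⟩ := h 0 0 (Pi.single i₀ fun _ => 1)
  have hx' : IsTrajectory (fun x u => networkCLM A b T α G leaders β (x, u)) 0 τ v x := hx
  let Φ : (∀ i, Fin (m i) → ℝ) →L[ℝ] (∀ i, Fin (m i) → ℝ) :=
    ContinuousLinearMap.pi fun i =>
      if G.graph.connectedComponentMk i = C then
        ContinuousLinearMap.proj (R := ℝ) (φ := fun i => Fin (m i) → ℝ) i else 0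
  have hΦ : ∀ x i, G.graph.connectedComponentMk i = C → Φ x i = x i := fun x i hi => by
    simp [Φ, hi]
  have hΦ' : ∀ x i, G.graph.connectedComponentMk i ≠ C → Φ x i = 0 := fun x i hi => by
    simp [Φ, hi]
  have haut : ∀ x u, Φ (networkCLM A b T α G leaders β (x, u)) =
      Φ (networkCLM A b T α G leaders β (Φ x, 0)) := by
    intro x u
    funext i
    by_cases hi : G.graph.connectedComponentMk i = C
    · have hil : i ∉ leaders := fun hl => hC i hl hi
      rw [hΦ _ i hi, hΦ _ i hi, networkCLM_apply, networkCLM_apply]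
      simp only [networkField, protocol, externalInput, hil, hΦ x i hi, dite_false]
      congr 4
      refine Finset.sum_congr rfl fun j _ => ?_
      by_cases hij : G.graph.Adj i j
      · have hj : G.graph.connectedComponentMk j = C := by
          rw [← hi]; exact SimpleGraph.ConnectedComponent.sound hij.symm.reachable
        rw [hΦ x j hj]
      · rw [G.weight_zero i j hij, zero_mul, zero_mul]
    · rw [hΦ' _ i hi, hΦ' _ i hi]
  have hz := eq_zero_of_eq_integral_clm
    (Φ.comp ((networkCLM A b T α G leaders β).comp (.inl ℝ _ _))) (t₀ := 0) (T := τ)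
    (y := fun t => Φ (x t)) (Φ.continuous.comp_continuousOn hx.2.1)
    (fun t ht => by
      rw [hx'.clm_apply_eq Φ ht, hx₀, map_zero, zero_add]
      exact intervalIntegral.integral_congr fun s _ => haut _ _)
    (t := τ) ⟨hτ.le, le_rfl⟩
  have h1 := congrFun (congrFun hz i₀) ⟨0, hm i₀⟩
  rw [hx₁, hΦ _ i₀ hi₀] at h1
  simp at h1

end Network

/-! ### Left eigenvectors of the network in canonical coordinates -/

/-- The nilpotent shift `z ↦ (z₂, …, z_m, 0)`, the vector field of a chain of integrators. -/
def chainShift {m : ℕ} (z : Fin m → ℝ) : Fin m → ℝ :=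
  fun k => if h : (k : ℕ) + 1 < m then z ⟨k + 1, h⟩ else 0

theorem companionForm_mulVec {m : ℕ} (α z : Fin m → ℝ) :
    companionForm α *ᵥ z = chainShift z + (α ⬝ᵥ z) • lastVector m := by
  funext k
  simp only [Matrix.mulVec, companionForm, dotProduct, Matrix.of_apply, Pi.add_apply, chainShift,
    Pi.smul_apply, lastVector, smul_eq_mul]
  by_cases hk : (k : ℕ) + 1 = m
  · simp [hk]
  · have hk' : (k : ℕ) + 1 < m := by omega
    simp only [hk, if_false, hk', dif_pos, mul_zero, add_zero]
    rw [Finset.sum_eq_single ⟨k + 1, hk'⟩]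
    · simp
    · intro j _ hj
      rw [if_neg fun h => hj (Fin.ext h), zero_mul]
    · simp

theorem chainShift_single_zero {m : ℕ} (h : 0 < m) :
    chainShift (Pi.single (⟨0, h⟩ : Fin m) (1 : ℝ)) = 0 := by
  funext k
  simp only [chainShift]
  split_ifs with hk
  · rw [Pi.single_eq_of_ne (by simp [Fin.ext_iff])]; rfl
  · rfl

theorem chainShift_single_succ {m k : ℕ} (h : k + 1 < m) :
    chainShift (Pi.single (⟨k + 1, h⟩ : Fin m) (1 : ℝ)) =
      Pi.single (⟨k, k.lt_succ_self.trans h⟩ : Fin m) 1 := by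
  funext j
  simp only [chainShift, Pi.single_apply, Fin.ext_iff]
  split_ifs <;> first | rfl | omega

theorem lastVector_eq_single {m : ℕ} (h : 0 < m) :
    lastVector m = Pi.single (⟨m - 1, by omega⟩ : Fin m) 1 := by
  funext j
  simp only [lastVector, Pi.single_apply, Fin.ext_iff]
  split_ifs <;> first | rfl | omega

section Canonical

variable {n : ℕ} {m : Fin n → ℕ}

/-- The network in canonical coordinates, without external control: chains of integrators coupled
through the outputs `β_iᵀ z_i`. -/
def canonicalField (G : WeightedGraph (Fin n)) (β z : ∀ i, Fin (m i) → ℝ) :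
    ∀ i, Fin (m i) → ℝ :=
  fun i => chainShift (z i) +
    (∑ j, G.weight i j * (β j ⬝ᵥ z j - β i ⬝ᵥ z i)) • lastVector (m i)

theorem networkField_canonical {A : ∀ i, Matrix (Fin (m i)) (Fin (m i)) ℝ}
    {b : ∀ i, Fin (m i) → ℝ} {T : ∀ i, Matrix (Fin (m i)) (Fin (m i)) ℝ}
    {α : ∀ i, Fin (m i) → ℝ} (hT : ∀ i, IsCanonicalForm (A i) (b i) (T i) (α i))
    (G : WeightedGraph (Fin n)) (leaders : Finset (Fin n)) (β z : ∀ i, Fin (m i) → ℝ) :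
    networkField A b T α G leaders β (fun i => (T i)⁻¹ *ᵥ z i) 0 =
      fun i => (T i)⁻¹ *ᵥ canonicalField G β z i := by
  have hTT : ∀ i, T i *ᵥ ((T i)⁻¹ *ᵥ z i) = z i := fun i => by
    rw [Matrix.mulVec_mulVec, Matrix.mul_nonsing_inv _ (hT i).1, Matrix.one_mulVec]
  funext i
  obtain ⟨hu, hA, hb⟩ := hT i
  have hb' : b i = (T i)⁻¹ *ᵥ lastVector (m i) := by
    rw [← hb, Matrix.mulVec_mulVec, Matrix.nonsing_inv_mul _ hu, Matrix.one_mulVec]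
  have hA' : A i *ᵥ ((T i)⁻¹ *ᵥ z i) = (T i)⁻¹ *ᵥ (companionForm (α i) *ᵥ z i) := by
    rw [← hA, Matrix.mulVec_mulVec, Matrix.mulVec_mulVec, ← Matrix.mul_assoc, ← Matrix.mul_assoc,
      Matrix.nonsing_inv_mul _ hu, Matrix.one_mul]
  have he : externalInput leaders 0 i = 0 := by simp [externalInput]
  simp only [networkField, protocol, hTT, hA', he, companionForm_mulVec, canonicalField]
  rw [hb', ← Matrix.mulVec_smul, ← Matrix.mulVec_add]
  congr 1
  module

/-- With the gains `β_i = (c_i, 0, …, 0)ᵀ`, a left eigenvector `P` of the canonical network is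
determined by the numbers `q_i = P (single i lastVector)`, since each chain of integrators passes
its last entry down; and these numbers solve the spectral equation. -/
theorem canonicalField_left_eigenvector (hm : ∀ i, 0 < m i) (G : WeightedGraph (Fin n))
    (c : Fin n → ℝ) {P : (∀ i, Fin (m i) → ℝ) →ₗ[ℝ] ℂ} {μ : ℂ}
    (hP : ∀ z, P (canonicalField G (fun i => Pi.single ⟨0, hm i⟩ (c i)) z) = μ * P z)
    {q : Fin n → ℂ} (hq : ∀ i, q i = P (Pi.single i (lastVector (m i)))) :
    (∀ i, μ ^ m i * q i = c i * ∑ j, (G.weight i j : ℂ) * (q j - q i)) ∧ (q = 0 → P = 0) := by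
  -- The eigenvector equation on the basis vectors of agent `i`.
  have hbasis : ∀ i (k : Fin (m i)), μ * P (Pi.single i (Pi.single k 1)) =
      P (Pi.single i (chainShift (Pi.single k 1))) +
        (if k = ⟨0, hm i⟩ then (c i : ℂ) else 0) *
          ∑ j, (G.weight i j : ℂ) * (q j - q i) := by
    intro i k
    set z : ∀ i, Fin (m i) → ℝ := Pi.single i (Pi.single k 1) with hz
    set d : ℝ := if k = ⟨0, hm i⟩ then c i else 0 with hd
    have hout : ∀ j, (Pi.single ⟨0, hm j⟩ (c j) : Fin (m j) → ℝ) ⬝ᵥ z j =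
        if j = i then d else 0 := by
      intro j
      by_cases hj : j = i
      · subst hj
        simp [hz, hd, Pi.single_apply]
      · simp [hz, hj]
    have hsum : canonicalField G (fun i => Pi.single ⟨0, hm i⟩ (c i)) z =
        Pi.single i (chainShift (Pi.single k 1)) +
          (∑ j, (d * G.weight i j) • (Pi.single j (lastVector (m j)) : ∀ i, Fin (m i) → ℝ) -
            ∑ j, (d * G.weight i j) • (Pi.single i (lastVector (m i)) : ∀ i, Fin (m i) → ℝ)) := by
      funext l
      simp only [canonicalField, hout, Pi.add_apply, Pi.sub_apply, Finset.sum_apply,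
        Pi.smul_apply]
      have hs : ∑ j, (d * G.weight i j) •
          (Pi.single j (lastVector (m j)) : ∀ i, Fin (m i) → ℝ) l =
          (d * G.weight i l) • lastVector (m l) := by
        rw [Finset.sum_eq_single l]
        · simp
        · intro j _ hj
          rw [Pi.single_eq_of_ne hj.symm, smul_zero]
        · simp
      rw [hs, ← Finset.sum_smul]
      by_cases hl : l = i
      · subst hl
        simp only [hz, Pi.single_eq_same, if_true, mul_sub, Finset.sum_sub_distrib, mul_ite,
          mul_zero, Finset.sum_ite_eq', Finset.mem_univ, ← Finset.mul_sum, ← Finset.sum_mul]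
        module
      · have hzl : chainShift (z l) = 0 := by
          funext p
          simp [hz, hl, chainShift]
        simp only [hzl, hl, if_false, Pi.single_eq_of_ne hl, smul_zero, sub_zero, mul_ite,
          mul_zero, Finset.sum_ite_eq', Finset.mem_univ, if_true, G.weight_symm l i, mul_comm d]
    rw [← hP z, hsum]
    simp only [map_add, map_sub, map_sum, map_smul, ← hq]
    rw [← Finset.sum_sub_distrib, Finset.mul_sum]
    congr 1
    refine Finset.sum_congr rfl fun j _ => ?_
    have hdc : (if k = ⟨0, hm i⟩ then (c i : ℂ) else 0) = (d : ℂ) := by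
      rw [hd]; split_ifs <;> simp
    rw [hdc, Complex.real_smul, Complex.real_smul]
    push_cast
    ring
  have hzero : ∀ i, μ * P (Pi.single i (Pi.single ⟨0, hm i⟩ 1)) =
      c i * ∑ j, (G.weight i j : ℂ) * (q j - q i) := fun i => by
    rw [hbasis, chainShift_single_zero]
    simp
  have hsucc : ∀ i k (hk : k + 1 < m i), μ * P (Pi.single i (Pi.single ⟨k + 1, hk⟩ 1)) =
      P (Pi.single i (Pi.single ⟨k, k.lt_succ_self.trans hk⟩ 1)) := fun i k hk => by
    rw [hbasis, chainShift_single_succ]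
    simp
  constructor
  · intro i
    have hpow : ∀ k (hk : k < m i), μ ^ (k + 1) * P (Pi.single i (Pi.single ⟨k, hk⟩ 1)) =
        c i * ∑ j, (G.weight i j : ℂ) * (q j - q i) := by
      intro k
      induction k with
      | zero => intro hk; rw [zero_add, pow_one, hzero]
      | succ k ih =>
        intro hk
        rw [pow_succ, mul_assoc, hsucc, ih]
    rw [← hpow (m i - 1) (by have := hm i; omega), Nat.sub_add_cancel (hm i), hq i,
      lastVector_eq_single (hm i)]
  · intro hq0
    have hdown : ∀ i d k (hk : k < m i), k + d + 1 = m i →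
        P (Pi.single i (Pi.single ⟨k, hk⟩ 1)) = 0 := by
      intro i d
      induction d with
      | zero =>
        intro k hk hkm
        have h := congrFun hq0 i
        rw [hq i, lastVector_eq_single (hm i)] at h
        obtain rfl : k = m i - 1 := by omega
        exact h
      | succ d ih =>
        intro k hk hkm
        rw [← hsucc i k (by omega), ih (k + 1) (by omega) (by omega), mul_zero]
    refine LinearMap.pi_ext' fun i => LinearMap.pi_ext' fun k => LinearMap.ext_ring ?_
    exact hdown i (m i - 1 - k) k k.2 (by have := k.2; omega)

end Canonical

/-- If every agent is in canonical form and each component has a leader, then gains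
`β_i = (c_i, 0, …, 0)ᵀ` with the `c_i` algebraically independent over the field of the weights make
the closed-loop network controllable. -/
theorem networkControllableUniformGains_of_isCanonicalForm {n : ℕ} {m : Fin n → ℕ}
    (hm : ∀ i, 0 < m i) {A : ∀ i, Matrix (Fin (m i)) (Fin (m i)) ℝ} {b : ∀ i, Fin (m i) → ℝ}
    {T : ∀ i, Matrix (Fin (m i)) (Fin (m i)) ℝ} {α : ∀ i, Fin (m i) → ℝ}
    (hT : ∀ i, IsCanonicalForm (A i) (b i) (T i) (α i)) {G : WeightedGraph (Fin n)}
    {leaders : Finset (Fin n)} (hG : LeaderFollowerConnected G leaders) :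
    NetworkControllableUniformGains A b T α G leaders := by
  let W : Set ℂ := range fun ij : Fin n × Fin n => (G.weight ij.1 ij.2 : ℂ)
  have hW : Cardinal.mk (Subfield.closure W) ≤ Cardinal.aleph0 :=
    (Subfield.cardinalMk_closure_le_max W).trans
      (max_le (Cardinal.mk_le_aleph0_iff.2 (finite_range _).countable.to_subtype) le_rfl)
  obtain ⟨c, hc⟩ := exists_algebraicIndependent_real (ι := Fin n) (Subfield.closure W) hW
  refine ⟨fun i => Pi.single ⟨0, hm i⟩ (c i), ?_⟩
  set β : ∀ i, Fin (m i) → ℝ := fun i => Pi.single ⟨0, hm i⟩ (c i) with hβ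
  let L := networkCLM A b T α G leaders β
  have hL : networkField A b T α G leaders β =
      fun x v => L.comp (.inl ℝ _ _) x + L.comp (.inr ℝ _ _) v := by
    funext x v
    rw [← networkCLM_apply]
    simp [L, ← map_add]
  rw [hL]
  refine isControllable_of_hautus _ _ fun p μ hp hpB => ?_
  -- `P` is the functional `p` in canonical coordinates.
  let J : (∀ i, Fin (m i) → ℝ) →ₗ[ℝ] (∀ i, Fin (m i) → ℝ) :=
    LinearMap.pi fun i => ((T i)⁻¹).mulVecLin ∘ₗ LinearMap.proj i
  let P : (∀ i, Fin (m i) → ℝ) →ₗ[ℝ] ℂ := p ∘ₗ J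
  have hP : ∀ z, P (canonicalField G β z) = μ * P z := fun z => by
    refine Eq.trans ?_ (hp (J z))
    exact congrArg p (networkField_canonical hT G leaders β z).symm
  have hb : ∀ i, J (Pi.single i (lastVector (m i))) = Pi.single i (b i) := by
    intro i
    funext j
    by_cases hj : j = i
    · subst hj
      simp [J, ← (hT j).2.2, Matrix.mulVec_mulVec, Matrix.nonsing_inv_mul _ (hT j).1]
    · simp [J, hj]
  obtain ⟨hq, hq0⟩ := canonicalField_left_eigenvector hm G c hP
    (q := fun i => P (Pi.single i (lastVector (m i)))) fun i => rfl
  have hleaders : ∀ i ∈ leaders, P (Pi.single i (lastVector (m i))) = 0 := by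
    intro i hi
    have hBi : L.comp (.inr ℝ _ _) (Pi.single (⟨i, hi⟩ : {i // i ∈ leaders}) (1 : ℝ)) =
        Pi.single i (b i) := by
      change networkField A b T α G leaders β 0 _ = _
      funext j
      by_cases hj : j = i
      · subst hj
        simp [networkField, protocol, externalInput, hi]
      · simp [networkField, protocol, externalInput, hj]
    change p (J _) = 0
    rw [hb, ← hBi, hpB]
  have hP0 : P = 0 := hq0 (eq_zero_of_spectral_equation hG (K := Subfield.closure W)
    (fun i j => Subfield.subset_closure ⟨(i, j), rfl⟩) hc hm hq hleaders)
  refine LinearMap.ext fun x => ?_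
  have hx : J (fun i => T i *ᵥ x i) = x := by
    funext i
    simp [J, Matrix.mulVec_mulVec, Matrix.nonsing_inv_mul _ (hT i).1]
  rw [← hx]
  exact LinearMap.congr_fun hP0 _

theorem mainTheorem1 {n : ℕ} (m : Fin n → ℕ) (hm : ∀ i, 0 < m i)
    (A : ∀ i, Matrix (Fin (m i)) (Fin (m i)) ℝ) (b : ∀ i, Fin (m i) → ℝ)
    (T : ∀ i, Matrix (Fin (m i)) (Fin (m i)) ℝ) (α : ∀ i, Fin (m i) → ℝ)
    (hT : ∀ i, PairControllable (A i) (b i) → IsCanonicalForm (A i) (b i) (T i) (α i))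
    (G : WeightedGraph (Fin n)) (leaders : Finset (Fin n)) :
    (NetworkControllable A b T α G leaders ↔
      (∀ i, PairControllable (A i) (b i)) ∧ LeaderFollowerConnected G leaders) ∧
    (NetworkControllableUniformGains A b T α G leaders ↔
      (∀ i, PairControllable (A i) (b i)) ∧ LeaderFollowerConnected G leaders) := by
  have hsuff : (∀ i, PairControllable (A i) (b i)) ∧ LeaderFollowerConnected G leaders →
      NetworkControllableUniformGains A b T α G leaders := fun h =>
    networkControllableUniformGains_of_isCanonicalForm hm (fun i => hT i (h.1 i)) h.2
  have huniform : NetworkControllableUniformGains A b T α G leaders →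
      NetworkControllable A b T α G leaders := fun ⟨β, hβ⟩ t₀ x₀ x₁ => ⟨β, hβ t₀ x₀ x₁⟩
  have hnec : NetworkControllable A b T α G leaders →
      (∀ i, PairControllable (A i) (b i)) ∧ LeaderFollowerConnected G leaders := fun h =>
    ⟨h.pairControllable, h.leaderFollowerConnected hm⟩
  exact ⟨⟨hnec, fun h => huniform (hsuff h)⟩, ⟨fun h => hnec (huniform h), hsuff⟩⟩
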